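/- Let $n\ge 1$ nodes $v_1,\dots,v_n$ have costs $c(v_j)>0$ and let $c_{\max}=\max_j c(v_j)/\min_j c(v_j)$. A matrix $U\in\{0,1\}^{n\times m}$ is strongly separating if for all $i\ne j$ there are columns $p,q$ with $U(i,p)=1,\ U(j,p)=0$ and $U(i,q)=0,\ U(j,q)=1$. Its cost is $\sum_{j=1}^n c(v_j)\,\|U(j)\|_1$, where $U(j)$ is the $j$th row. A $\rho$-approximation is a strongly separating $n\times m$ matrix whose cost is at most $\rho$ times the minimum cost of such matrices. Algorithm $\epsilon$-SSMatrix: find $k$ with $\binom{m}{k-1}<n\le\binom{m}{k}$. For $t=0,1,\dots,n$ let $A_t$ be the first $t$ vectors of weight $k$ in the colexicographic ordering of $\{0,1\}^m$, and let $\partial(A_t)$ be the shadow of $A_t$ (all vectors obtained from a member of $A_t$ by changing one $1$ to $0$). Take the first $t\le n$ with $t-|\partial(A_t)|+\binom{m}{k-1}\ge n$; let $\tilde U$ have as its last $t$ rows the vectors of $A_t$ and as its first $n-t$ rows arbitrary distinct vectors of weight $k-1$ not in $\partial(A_t)$. Return the matrix $U$ that assigns the rows of $\tilde U$, in increasing order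 of weight, to the nodes in decreasing order of cost. (We say that the algorithm "returns a $\rho$-approximation" if it can be carried out, and its output is a $\rho$-approximation however the free choices are made and ties are broken.) Statement. (i) Let $0<\epsilon\le 1$, let $\binom{m}{k-1}<n\le\binom{m}{k}$ and $2\log_2 n\le m\le n^{\epsilon/6}$. If $c_{\max}\le \frac{\epsilon}{6}\,2^{(\epsilon k/6)\log_2(m/(2k))}$, then $\epsilon$-SSMatrix returns a $(1+\epsilon)$-approximation. (ii) (a) For every constant $c_1>1$ there is a constant $\delta>0$, depending only on $c_1$, such that for all $0<\epsilon\le1$ and all $n\ge 1$, $m$ with $(2\log_2 n)^{c_1}\le m\le n^{\epsilon/6}$: the bound on $c_{\max}$ in (i) satisfies $\frac{\epsilon}{6}\,2^{(\epsilon k/6)\log_2(m/(2k))}\ge\frac{\epsilon}{6}\,n^{\delta\epsilon}$ for every $k$ with $\binom{m}{k-1}<n\le\binom{m}{k}$; and if $c_{\max}\le\frac{\epsilon}{6}\,n^{\delta\epsilon}$, then $\epsilon$-SSMatrix returns a $(1+\epsilon)$-approximation. (b) For every constant $c_2$ there is a constant $\delta>0$, depending only on $c_2$, such that the same two conclusions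 hold for all $0<\epsilon\le1$ and all $n\ge1$, $m$ with $4\log_2 n\le m\le c_2\log_2 n$. -/

import Mathlib

open Finset
open scoped FinsetFamily

/-- The support of the `i`-th row of a 0/1 matrix (`true` is the entry `1`). Binary vectors of
length `m` are identified with their supports, which are subsets of `Fin m`. -/
def rowSupport {n m : ℕ} (U : Matrix (Fin n) (Fin m) Bool) (i : Fin n) : Finset (Fin m) :=
  {j | U i j = true}

/-- The weight `‖U(i)‖₁` of the `i`-th row: its number of ones. -/
def rowWeight {n m : ℕ} (U : Matrix (Fin n) (Fin m) Bool) (i : Fin n) : ℕ :=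
  (rowSupport U i).card

/-- Strongly separating matrices. -/
def StronglySeparating {n m : ℕ} (U : Matrix (Fin n) (Fin m) Bool) : Prop :=
  ∀ i j : Fin n, i ≠ j →
    (∃ p : Fin m, U i p = true ∧ U j p = false) ∧ (∃ q : Fin m, U i q = false ∧ U j q = true)

/-- The linear cost `∑ⱼ c(vⱼ) ‖U(j)‖₁`. -/
def linearCost {n m : ℕ} (c : Fin n → ℝ) (U : Matrix (Fin n) (Fin m) Bool) : ℝ :=
  ∑ j, c j * (rowWeight U j : ℝ)

/-- `U` is a feasible solution of the problem of minimising the linear cost over all strongly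
separating `n × m` matrices, and its cost is at most `α` times that of every feasible solution
(hence at most `α` times the optimum). -/
def IsApproxSolution {n m : ℕ} (α : ℝ) (c : Fin n → ℝ) (U : Matrix (Fin n) (Fin m) Bool) : Prop :=
  StronglySeparating U ∧
    ∀ W : Matrix (Fin n) (Fin m) Bool, StronglySeparating W → linearCost c U ≤ α * linearCost c W

/-- The ratio `(max c) / (min c)` (used for `n ≥ 1` and positive costs). -/
noncomputable def costRatio {n : ℕ} (c : Fin n → ℝ) : ℝ :=
  (⨆ i, c i) / (⨅ i, c i)

/-- The first `t` vectors of weight `k` in the colexicographic ordering of `{0,1}^m`: those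
weight-`k` vectors that are preceded by fewer than `t` vectors of weight `k`. -/
def colexFirst (m k t : ℕ) : Finset (Finset (Fin m)) :=
  {s ∈ powersetCard k univ | #{r ∈ powersetCard k univ | toColex r < toColex s} < t}

/-- The level chosen by the algorithm: `C(m, k-1) < n ≤ C(m, k)` (for `k = 0` this is never
satisfied). -/
def IsLevel (n m k : ℕ) : Prop :=
  m.choose (k - 1) < n ∧ n ≤ m.choose k

/-- The test `t - |∂ A_t| + C(m, k-1) ≥ n` of the loop, where `A_t` consists of the first `t`
vectors of weight `k` in colex order and `∂` is the shadow. -/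
def StopTest (n m k t : ℕ) : Prop :=
  (n : ℤ) ≤ (t : ℤ) - (#(∂ (colexFirst m k t)) : ℤ) + (m.choose (k - 1) : ℤ)

/-- A run of the algorithm `ε-SSMatrix` on nodes `Fin n` with costs `c` and budget `m`. The
choices that the algorithm leaves open are arguments: the order in which the vectors of `A_t` are
placed, which vectors of weight `k - 1` outside `∂ A_t` are used, and how ties are broken when the
rows are sorted by weight (`ζ`) and the nodes by cost (`ν`; `ν i` is the node with the `i`-th
largest cost). Row `U j` of the output belongs to node `j`. -/
structure SSMatrixRun {n m : ℕ} (c : Fin n → ℝ) (k t : ℕ) (T : Matrix (Fin n) (Fin m) Bool)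
    (ζ ν : Equiv.Perm (Fin n)) (U : Matrix (Fin n) (Fin m) Bool) : Prop where
  level : IsLevel n m k
  t_le : t ≤ n
  loop_test : StopTest n m k t
  loop_first : ∀ s < t, ¬ StopTest n m k s
  /-- the last `t` rows of `T` are the vectors of `A_t`, each used once -/
  top_rows : Set.BijOn (rowSupport T) {j | n ≤ (j : ℕ) + t} (colexFirst m k t : Set (Finset (Fin m)))
  /-- the other rows are vectors of weight `k - 1` outside the shadow of `A_t` -/
  low_rows : ∀ j : Fin n, (j : ℕ) + t < n →
    rowWeight T j = k - 1 ∧ rowSupport T j ∉ ∂ (colexFirst m k t)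
  /-- no vector is used twice -/
  low_inj : Set.InjOn (rowSupport T) {j | (j : ℕ) + t < n}
  sort_rows : Monotone fun i => rowWeight T (ζ i)
  sort_nodes : Antitone fun i => c (ν i)
  output : ∀ i, U (ν i) = T (ζ i)

/-- `U` is a possible output of the algorithm `ε-SSMatrix`. -/
def IsSSMatrixOutput {n m : ℕ} (c : Fin n → ℝ) (U : Matrix (Fin n) (Fin m) Bool) : Prop :=
  ∃ (k t : ℕ) (T : Matrix (Fin n) (Fin m) Bool) (ζ ν : Equiv.Perm (Fin n)), SSMatrixRun c k t T ζ ν U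

/-- On costs `c` and budget `m`, the algorithm `ε-SSMatrix` does return a matrix, and whatever it
returns is an `α`-approximate solution. -/
def SSMatrixApprox {n : ℕ} (α : ℝ) (m : ℕ) (c : Fin n → ℝ) : Prop :=
  (∃ U : Matrix (Fin n) (Fin m) Bool, IsSSMatrixOutput c U) ∧
    ∀ U : Matrix (Fin n) (Fin m) Bool, IsSSMatrixOutput c U → IsApproxSolution α c U

/-- The explicit bound `(ε/6) · 2^{(εk/6) log₂(m/(2k))}` on the cost ratio. -/
noncomputable def costBound (ε : ℝ) (m k : ℕ) : ℝ :=
  ε / 6 * (2 : ℝ) ^ (ε * k / 6 * Real.logb 2 ((m : ℝ) / (2 * k)))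

/-!
The rows of a strongly separating matrix form an antichain of `n` sets, and the algorithm uses only
the levels `k - 1` and `k`, where `C(m, k - 1) < n ≤ C(m, k)`. Its output is strongly separating
because the rows of weight `k - 1` avoid the shadow of those of weight `k`, and it costs at most
`k * ∑ c`. The exact number of rows of weight `k` plays no role for the approximation ratio.

For the lower bound let `q = ⌈ε k / 6⌉`. By the LYM inequality an antichain has at most
`C(m, k - 1 - q)` members of size at most `k - 1 - q`, and
`C(m, k - 1 - q) ≤ (2k / m) ^ q * C(m, k - 1) < (2k / m) ^ q * n`. Hence, if the cost ratio is at
most `(ε / 6) (m / (2k)) ^ (ε k / 6)`, the rows of weight at most `k - 1 - q` carry at most the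
fraction `ε / 6` of the total node cost (`StronglySeparating.sum_cost_light_le`). All other rows
have weight at least `(1 - ε / 3) k` as soon as `ε k ≥ 6`, so every strongly separating matrix costs
at least `(1 - ε / 3) (1 - ε / 6) k * ∑ c` (`StronglySeparating.le_linearCost`), and
`(1 + ε) (1 - ε / 3) (1 - ε / 6) ≥ 1`. Thus the guarantee holds whenever the level exists, `ε k ≥ 6`
and the cost ratio is bounded (`ssMatrixApprox_of_isLevel`).

It remains to control `k`. The bound `n ≤ C(m, k) ≤ m ^ k ≤ n ^ (ε k / 6)` gives `ε k ≥ 6` when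
`m ≤ n ^ (ε / 6)`. When `n ≥ 2` and `m` is in either of the ranges of the second part,
`n ≤ 3 ^ ⌊m / 3⌋ ≤ C(m, ⌊m / 3⌋)`, so the level exists and `3 k ≤ m`; then
`n ≤ C(m, k) ≤ (m / (2k)) ^ (7k)`, which turns the explicit bound on the cost ratio into a power of
`n` with an absolute `δ = 1 / 42` (`IsLevel.rpow_le_costBound`). When `m ≤ c₂ log₂ n`, the level `k`
is of order `log₂ n` (`IsLevel.logb_le_mul`), and a cost ratio between `1` and `(ε / 6) n ^ (δ ε)`
forces `δ ε log₂ n ≥ 2`; for small `δ` this yields `ε k ≥ 6`.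
-/

/-! ### Binomial coefficients and the level of the algorithm -/

lemma choose_le_choose_of_two_mul_le {m a b : ℕ} (hab : a ≤ b) (hb : 2 * b ≤ m) :
    m.choose a ≤ m.choose b := by
  induction b, hab using Nat.le_induction with
  | base => exact le_rfl
  | succ b _ ih => exact (ih (by omega)).trans (Nat.choose_le_succ_of_lt_half_left (by omega))

lemma pow_three_le_choose {a m : ℕ} (h : 3 * a ≤ m) : 3 ^ a ≤ m.choose a := by
  induction a generalizing m with
  | zero => simp
  | succ a ih =>
    obtain ⟨m, rfl⟩ : ∃ m', m = m' + 1 := ⟨m - 1, by omega⟩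
    have h1 := Nat.add_one_mul_choose_eq m a
    have h2 := ih (m := m) (by omega)
    have h3 : 3 * (a + 1) * m.choose a ≤ (m + 1) * m.choose a := Nat.mul_le_mul_right _ h
    have h4 : (3 * m.choose a) * (a + 1) ≤ (m + 1).choose (a + 1) * (a + 1) := by
      rw [← h1]; linarith
    have h5 := Nat.le_of_mul_le_mul_right h4 (Nat.succ_pos a)
    rw [pow_succ]; omega

lemma IsLevel.one_le {n m k : ℕ} (h : IsLevel n m k) : 1 ≤ k := by
  rcases Nat.eq_zero_or_pos k with rfl | hk
  · have := h.1.trans_le h.2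
    simp at this
  · exact hk

/-- Binomial coefficients strictly increase only up to the middle. -/
lemma IsLevel.two_mul_le {n m k : ℕ} (h : IsLevel n m k) : 2 * k ≤ m := by
  have hlt := h.1.trans_le h.2
  obtain ⟨j, rfl⟩ : ∃ j, k = j + 1 := ⟨k - 1, by have := h.one_le; omega⟩
  rw [Nat.add_sub_cancel] at hlt
  have h1 := Nat.choose_succ_right_eq m j
  by_contra! hc
  have h2 : m.choose j * (m - j) ≤ m.choose j * (j + 1) := Nat.mul_le_mul_left _ (by omega)
  rw [← h1] at h2
  exact absurd (Nat.le_of_mul_le_mul_right h2 (Nat.succ_pos j)) (by omega)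

lemma IsLevel.two_le {n m k : ℕ} (h : IsLevel n m k) : 2 ≤ n := by
  have h1 := h.1
  have := Nat.choose_pos (n := m) (k := k - 1) (by have := h.two_mul_le; omega)
  omega

lemma IsLevel.le_of_le_choose {n m k a : ℕ} (h : IsLevel n m k) (ha : n ≤ m.choose a) :
    k ≤ a := by
  by_contra! hc
  have := choose_le_choose_of_two_mul_le (m := m) (a := a) (b := k - 1) (by omega)
    (by have := h.two_mul_le; omega)
  have := h.1
  omega

lemma IsLevel.unique {n m k l : ℕ} (hk : IsLevel n m k) (hl : IsLevel n m l) : k = l :=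
  le_antisymm (hk.le_of_le_choose hl.2) (hl.le_of_le_choose hk.2)

lemma exists_isLevel {n m a : ℕ} (hn : 2 ≤ n) (ha : n ≤ m.choose a) : ∃ k, IsLevel n m k := by
  classical
  have hex : ∃ k, n ≤ m.choose k := ⟨a, ha⟩
  have h0 : Nat.find hex ≠ 0 := fun h0 => by
    have := Nat.find_spec hex
    rw [h0, Nat.choose_zero_right] at this
    omega
  exact ⟨Nat.find hex, not_le.1 (Nat.find_min hex (by omega)), Nat.find_spec hex⟩

/-- Going `q` levels down from level `j < k` divides the size of the level by at least
`(m / (2k)) ^ q`, since `(m - i) / (i + 1) ≥ m / (2k)` for `i < k ≤ m / 2`. -/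
lemma choose_sub_mul_pow_le {m k j q : ℕ} (hk : 2 * k ≤ m) (hj : j < k) (hq : q ≤ j) :
    (m.choose (j - q) : ℝ) * ((m : ℝ) / (2 * k)) ^ q ≤ m.choose j := by
  induction q with
  | zero => simp
  | succ q ih =>
    have hstep : (m.choose (j - (q + 1)) : ℝ) * ((m : ℝ) / (2 * k)) ≤ m.choose (j - q) := by
      obtain ⟨i, hi⟩ : ∃ i, j - q = i + 1 := ⟨j - q - 1, by omega⟩
      rw [show j - (q + 1) = i by omega, hi]
      have h1 : (m.choose (i + 1) : ℝ) * (i + 1) = m.choose i * (m - i) := by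
        have := Nat.choose_succ_right_eq m i
        rw [← Nat.cast_sub (by omega)]
        exact_mod_cast this
      have hkpos : (0 : ℝ) < k := by exact_mod_cast (by omega : 0 < k)
      have hik : (i : ℝ) + 1 ≤ k := by exact_mod_cast (by omega : i + 1 ≤ k)
      have hkm : 2 * (k : ℝ) ≤ m := by exact_mod_cast hk
      have hr : (m : ℝ) / (2 * k) * (i + 1) ≤ m - i := by
        rw [div_mul_eq_mul_div, div_le_iff₀ (by positivity)]
        nlinarith
      have hc : (0 : ℝ) ≤ m.choose i := Nat.cast_nonneg _
      refine le_of_mul_le_mul_right ?_ (by positivity : (0 : ℝ) < i + 1)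
      rw [h1, mul_assoc]
      exact mul_le_mul_of_nonneg_left hr hc
    calc (m.choose (j - (q + 1)) : ℝ) * ((m : ℝ) / (2 * k)) ^ (q + 1)
        = (m.choose (j - (q + 1)) * ((m : ℝ) / (2 * k))) * ((m : ℝ) / (2 * k)) ^ q := by ring
      _ ≤ m.choose (j - q) * ((m : ℝ) / (2 * k)) ^ q :=
        mul_le_mul_of_nonneg_right hstep (by positivity)
      _ ≤ m.choose j := ih (by omega)

/-! ### Strongly separating matrices are antichains -/

lemma mem_rowSupport {n m : ℕ} {U : Matrix (Fin n) (Fin m) Bool} {i : Fin n} {p : Fin m} :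
    p ∈ rowSupport U i ↔ U i p = true := by
  simp [rowSupport]

lemma stronglySeparating_iff {n m : ℕ} {U : Matrix (Fin n) (Fin m) Bool} :
    StronglySeparating U ↔ ∀ i j, i ≠ j → ¬ rowSupport U i ⊆ rowSupport U j := by
  have key : ∀ i j, ¬ rowSupport U i ⊆ rowSupport U j ↔ ∃ p, U i p = true ∧ U j p = false := by
    intro i j
    simp [Finset.not_subset, mem_rowSupport]
  constructor
  · exact fun h i j hij => (key i j).2 (h i j hij).1
  · refine fun h i j hij => ⟨(key i j).1 (h i j hij), ?_⟩
    obtain ⟨q, hq⟩ := (key j i).1 (h j i hij.symm)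
    exact ⟨q, hq.2, hq.1⟩

/-- By the LYM inequality, a strongly separating matrix has at most `C(m, r)` rows of weight at
most `r ≤ m / 2`. -/
lemma StronglySeparating.card_weight_le {n m r : ℕ} {W : Matrix (Fin n) (Fin m) Bool}
    (hW : StronglySeparating W) (hr : 2 * r ≤ m) :
    #{i | rowWeight W i ≤ r} ≤ m.choose r := by
  rw [stronglySeparating_iff] at hW
  set S : Finset (Fin n) := {i | rowWeight W i ≤ r} with hS
  have hinj : Set.InjOn (rowSupport W) (S : Set (Fin n)) := fun i _ j _ hij => by
    by_contra hne
    exact hW i j hne hij.subset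
  have hanti : IsAntichain (· ⊆ ·) (S.image (rowSupport W) : Set (Finset (Fin m))) := by
    intro s hs t ht hst hsub
    simp only [coe_image, Set.mem_image] at hs ht
    obtain ⟨i, -, rfl⟩ := hs
    obtain ⟨j, -, rfl⟩ := ht
    exact hW i j (fun h => hst (by rw [h])) hsub
  have hlym := lubell_yamamoto_meshalkin_inequality_sum_inv_choose (𝕜 := ℝ) hanti
  rw [sum_image hinj, Fintype.card_fin] at hlym
  have hpos : (0 : ℝ) < m.choose r := by exact_mod_cast Nat.choose_pos (by omega)
  have hlow : (#S : ℝ) * (m.choose r : ℝ)⁻¹ ≤ ∑ i ∈ S, ((m.choose #(rowSupport W i) : ℕ) : ℝ)⁻¹ := by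
    rw [← nsmul_eq_mul]
    refine card_nsmul_le_sum _ _ _ fun i hi => ?_
    have hi' : #(rowSupport W i) ≤ r := (mem_filter.1 hi).2
    have h0 : 0 < m.choose #(rowSupport W i) := Nat.choose_pos (by omega)
    exact inv_anti₀ (by exact_mod_cast h0) (by exact_mod_cast choose_le_choose_of_two_mul_le hi' hr)
  have := hlow.trans hlym
  rw [← div_eq_mul_inv, div_le_one hpos] at this
  exact_mod_cast this

/-! ### Runs of the algorithm -/

/-- In a finite family `P`, exactly `t` members have fewer than `t` predecessors in `P`. -/
lemma card_filter_card_lt_lt {β : Type*} [LinearOrder β] (P : Finset β) {t : ℕ} (ht : t ≤ #P) :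
    #{s ∈ P | #{r ∈ P | r < s} < t} = t := by
  set rk : β → ℕ := fun s => #{r ∈ P | r < s} with hrk
  have hmono : ∀ a ∈ P, ∀ b, a < b → rk a < rk b := fun a ha b hab =>
    card_lt_card (ssubset_iff_of_subset (fun r hr => by
      simp only [mem_filter] at hr ⊢; exact ⟨hr.1, hr.2.trans hab⟩) |>.2
        ⟨a, by simp [ha, hab], by simp⟩)
  have hinj : Set.InjOn rk (P : Set β) := fun a ha b hb hab => by
    rcases lt_trichotomy a b with h | h | h
    · exact absurd hab (hmono a ha b h).ne
    · exact h
    · exact absurd hab (hmono b hb a h).ne'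
  have himg : P.image rk = range #P := by
    refine eq_of_subset_of_card_le (fun x hx => ?_) ?_
    · obtain ⟨s, hs, rfl⟩ := mem_image.1 hx
      exact mem_range.2
        (card_lt_card ((ssubset_iff_of_subset (filter_subset _ _)).2 ⟨s, hs, by simp⟩))
    · rw [card_image_of_injOn hinj, card_range]
  have himg2 : ({s ∈ P | rk s < t} : Finset β).image rk = range t := by
    ext x
    simp only [mem_image, mem_filter, mem_range]
    constructor
    · rintro ⟨s, hs, rfl⟩
      exact hs.2
    · intro hx
      have : x ∈ P.image rk := by rw [himg, mem_range]; omega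
      obtain ⟨s, hs, rfl⟩ := mem_image.1 this
      exact ⟨s, ⟨hs, hx⟩, rfl⟩
  rw [← card_image_of_injOn (hinj.mono (coe_subset.2 (filter_subset _ _))), himg2, card_range]

lemma card_colexFirst {m k t : ℕ} (ht : t ≤ m.choose k) : #(colexFirst m k t) = t := by
  have h := card_filter_card_lt_lt
    ((powersetCard k (univ : Finset (Fin m))).map toColex.toEmbedding) (t := t) (by simpa using ht)
  rw [filter_map, card_map] at h
  simp only [filter_map, card_map] at h
  exact h

lemma card_of_mem_colexFirst {m k t : ℕ} {s : Finset (Fin m)} (hs : s ∈ colexFirst m k t) :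
    #s = k := by
  simp only [colexFirst, mem_filter, mem_powersetCard] at hs
  exact hs.1.2

lemma shadow_colexFirst_subset (m k t : ℕ) :
    ∂ (colexFirst m k t) ⊆ powersetCard (k - 1) univ := fun s hs => by
  have : Set.Sized k (colexFirst m k t : Set (Finset (Fin m))) := fun _ h =>
    card_of_mem_colexFirst h
  simpa [mem_powersetCard] using this.shadow hs

/-- The loop stops at `t = n` at the latest. -/
lemma stopTest_self (n m k : ℕ) : StopTest n m k n := by
  have h := card_le_card (shadow_colexFirst_subset m k n)
  rw [card_powersetCard, card_univ, Fintype.card_fin] at h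
  unfold StopTest
  omega

/-- Two rows of equal weight are distinct; a row of weight `k - 1` contained in one of weight `k`
would lie in the shadow. -/
lemma SSMatrixRun.not_rowSupport_subset {n m k t : ℕ} {c : Fin n → ℝ}
    {T U : Matrix (Fin n) (Fin m) Bool} {ζ ν : Equiv.Perm (Fin n)}
    (h : SSMatrixRun c k t T ζ ν U) {i j : Fin n} (hij : i ≠ j) :
    ¬ rowSupport T i ⊆ rowSupport T j := by
  intro hsub
  have hk := h.level.one_le
  have htop : ∀ l : Fin n, n ≤ (l : ℕ) + t → rowSupport T l ∈ colexFirst m k t :=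
    fun l hl => h.top_rows.mapsTo hl
  rcases lt_or_ge ((i : ℕ) + t) n with hi | hi <;> rcases lt_or_ge ((j : ℕ) + t) n with hj | hj
  · have h1 := (h.low_rows i hi).1
    have h2 := (h.low_rows j hj).1
    unfold rowWeight at h1 h2
    exact hij (h.low_inj hi hj (eq_of_subset_of_card_le hsub (by omega)))
  · have h1 := (h.low_rows i hi).1
    refine (h.low_rows i hi).2 (mem_shadow_iff_exists_mem_card_add_one.2
      ⟨_, htop j hj, hsub, ?_⟩)
    have := card_of_mem_colexFirst (htop j hj)
    unfold rowWeight at h1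
    omega
  · have h1 := card_of_mem_colexFirst (htop i hi)
    have h2 := (h.low_rows j hj).1
    have h3 := card_le_card hsub
    unfold rowWeight at h2
    omega
  · have h1 := card_of_mem_colexFirst (htop i hi)
    have h2 := card_of_mem_colexFirst (htop j hj)
    exact hij (h.top_rows.injOn hi hj (eq_of_subset_of_card_le hsub (by omega)))

lemma SSMatrixRun.rowSupport_output {n m k t : ℕ} {c : Fin n → ℝ}
    {T U : Matrix (Fin n) (Fin m) Bool} {ζ ν : Equiv.Perm (Fin n)}
    (h : SSMatrixRun c k t T ζ ν U) (v : Fin n) :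
    rowSupport U v = rowSupport T (ζ (ν.symm v)) := by
  have := h.output (ν.symm v)
  rw [Equiv.apply_symm_apply] at this
  simp [rowSupport, this]

lemma SSMatrixRun.stronglySeparating {n m k t : ℕ} {c : Fin n → ℝ}
    {T U : Matrix (Fin n) (Fin m) Bool} {ζ ν : Equiv.Perm (Fin n)}
    (h : SSMatrixRun c k t T ζ ν U) : StronglySeparating U := by
  refine stronglySeparating_iff.2 fun i j hij => ?_
  rw [h.rowSupport_output, h.rowSupport_output]
  exact h.not_rowSupport_subset (by simpa using hij)

lemma SSMatrixRun.rowWeight_le {n m k t : ℕ} {c : Fin n → ℝ}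
    {T U : Matrix (Fin n) (Fin m) Bool} {ζ ν : Equiv.Perm (Fin n)}
    (h : SSMatrixRun c k t T ζ ν U) (v : Fin n) : rowWeight U v ≤ k := by
  rw [rowWeight, h.rowSupport_output]
  set j := ζ (ν.symm v)
  rcases lt_or_ge ((j : ℕ) + t) n with hj | hj
  · have := (h.low_rows j hj).1
    unfold rowWeight at this
    omega
  · exact (card_of_mem_colexFirst (h.top_rows.mapsTo hj)).le

lemma exists_isSSMatrixOutput {n m k : ℕ} (c : Fin n → ℝ) (hk : IsLevel n m k) :
    ∃ U : Matrix (Fin n) (Fin m) Bool, IsSSMatrixOutput c U := by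
  classical
  have hex : ∃ t, StopTest n m k t := ⟨n, stopTest_self n m k⟩
  obtain ⟨t, htn, ht, hfirst⟩ : ∃ t ≤ n, StopTest n m k t ∧ ∀ s < t, ¬ StopTest n m k s :=
    ⟨Nat.find hex, Nat.find_le (stopTest_self n m k), Nat.find_spec hex,
      fun s hs => Nat.find_min hex hs⟩
  have hA : #(colexFirst m k t) = t := card_colexFirst (htn.trans hk.2)
  obtain ⟨B, hBsub, hB⟩ : ∃ B ⊆ powersetCard (k - 1) univ \ ∂ (colexFirst m k t), #B = n - t := by
    refine exists_subset_card_eq ?_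
    rw [card_sdiff_of_subset (shadow_colexFirst_subset m k t), card_powersetCard, card_univ,
      Fintype.card_fin]
    unfold StopTest at ht
    omega
  -- Rows `0, …, n - t - 1` list the chosen vectors of weight `k - 1`, the last `t` rows list `A_t`.
  let eA := (colexFirst m k t).equivFinOfCardEq hA
  let eB := B.equivFinOfCardEq hB
  let f : Fin n → Finset (Fin m) := fun j =>
    if h : (j : ℕ) + t < n then eB.symm ⟨j, by omega⟩ else eA.symm ⟨j - (n - t), by omega⟩
  have flow : ∀ j : Fin n, ∀ h : (j : ℕ) + t < n, f j = eB.symm ⟨j, by omega⟩ :=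
    fun j h => dif_pos h
  have ftop : ∀ j : Fin n, ∀ h : n ≤ (j : ℕ) + t, f j = eA.symm ⟨j - (n - t), by omega⟩ :=
    fun j h => dif_neg (not_lt.2 h)
  let T : Matrix (Fin n) (Fin m) Bool := fun j p => decide (p ∈ f j)
  have hT : rowSupport T = f := by
    ext j p
    simp [rowSupport, T]
  let ζ := Tuple.sort fun j => rowWeight T j
  let ν := Tuple.sort fun j => -c j
  refine ⟨fun v => T (ζ (ν.symm v)), k, t, T, ζ, ν, hk, htn, ht, hfirst, ?_, ?_, ?_,
    Tuple.monotone_sort fun j => rowWeight T j, ?_, fun i => by simp⟩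
  · rw [hT]
    refine ⟨fun j hj => ?_, fun i hi j hj hij => ?_, fun s hs => ?_⟩
    · rw [ftop j hj]
      exact (eA.symm _).2
    · rw [ftop i hi, ftop j hj] at hij
      have := eA.symm.injective (Subtype.ext hij)
      simp only [Fin.mk.injEq, Set.mem_ofPred_eq] at this hi hj
      exact Fin.ext (by omega)
    · have hlt := (eA ⟨s, hs⟩).2
      refine ⟨⟨(eA ⟨s, hs⟩ : ℕ) + (n - t), by omega⟩, ?_, ?_⟩
      · simp only [Set.mem_ofPred_eq]
        omega
      · rw [ftop _ (by simp only; omega)]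
        simp
  · intro j hj
    have hmem : f j ∈ B := by
      rw [flow j hj]
      exact (eB.symm _).2
    have := hBsub hmem
    rw [mem_sdiff, mem_powersetCard] at this
    rw [rowWeight, hT]
    exact ⟨this.1.2, this.2⟩
  · rw [hT]
    intro i hi j hj hij
    rw [flow i hi, flow j hj] at hij
    have := eB.symm.injective (Subtype.ext hij)
    simp only [Fin.mk.injEq] at this
    exact Fin.ext this
  · intro i j hij
    exact neg_le_neg_iff.1 (Tuple.monotone_sort (fun j => -c j) hij)

/-! ### The approximation guarantee -/

lemma le_costRatio_mul {n : ℕ} {c : Fin n → ℝ} (hc : ∀ i, 0 < c i) (i j : Fin n) :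
    c i ≤ costRatio c * c j := by
  have : Nonempty (Fin n) := ⟨i⟩
  obtain ⟨l, hl⟩ := exists_eq_ciInf_of_finite (f := c)
  have h1 : c i ≤ ⨆ i, c i := le_ciSup (Set.finite_range c).bddAbove i
  have h2 : ⨅ i, c i ≤ c j := ciInf_le (Set.finite_range c).bddBelow j
  have h3 : 0 < ⨅ i, c i := hl ▸ hc l
  unfold costRatio
  rw [div_mul_eq_mul_div, le_div_iff₀ h3]
  exact mul_le_mul h1 h2 h3.le ((hc i).le.trans h1)

lemma one_le_costRatio {n : ℕ} (hn : 1 ≤ n) {c : Fin n → ℝ} (hc : ∀ i, 0 < c i) :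
    1 ≤ costRatio c := by
  have h := le_costRatio_mul hc ⟨0, hn⟩ ⟨0, hn⟩
  exact le_of_mul_le_mul_right (by rwa [one_mul]) (hc ⟨0, hn⟩)

lemma costBound_eq {n m k : ℕ} (h : IsLevel n m k) (ε : ℝ) :
    costBound ε m k = ε / 6 * ((m : ℝ) / (2 * k)) ^ (ε * k / 6) := by
  have hk : (0 : ℝ) < k := by exact_mod_cast h.one_le
  have hm : (0 : ℝ) < m := by
    exact_mod_cast (by have := h.one_le; have := h.two_mul_le; omega : 0 < m)
  rw [costBound, mul_comm (ε * k / 6), Real.rpow_mul (by norm_num),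
    Real.rpow_logb (by norm_num) (by norm_num) (by positivity)]

/-- If costs are balanced, the rows of weight at most `k - 1 - q` carry at most the fraction
`ε / 6` of the total cost: there are at most `C(m, k - 1 - q)` of them, which is smaller than `n`
by a factor of at least `(m / (2k)) ^ q`. -/
lemma StronglySeparating.sum_cost_light_le {n m k q : ℕ} {ε : ℝ} {c : Fin n → ℝ}
    {W : Matrix (Fin n) (Fin m) Bool} (hW : StronglySeparating W) (hk : IsLevel n m k)
    (hε : 0 < ε) (hc : ∀ i, 0 < c i) (hq : q ≤ k - 1) (hqε : ε * k / 6 ≤ q)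
    (hcost : costRatio c ≤ costBound ε m k) :
    ∑ i with rowWeight W i ≤ k - 1 - q, c i ≤ ε / 6 * ∑ i, c i := by
  set L : Finset (Fin n) := {i | rowWeight W i ≤ k - 1 - q} with hL
  set x : ℝ := (m : ℝ) / (2 * k) with hx
  have h1k := hk.one_le
  have h2k := hk.two_mul_le
  have hkpos : (0 : ℝ) < k := by exact_mod_cast h1k
  have hx1 : 1 ≤ x := by
    rw [hx, le_div_iff₀ (by positivity), one_mul]
    exact_mod_cast h2k
  have hcard : (#L : ℝ) ≤ m.choose (k - 1 - q) := by
    exact_mod_cast hW.card_weight_le (by omega)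
  have hnpos : (0 : ℝ) < n := by exact_mod_cast (by have := hk.two_le; omega : 0 < n)
  have hS : 0 ≤ ∑ i, c i := sum_nonneg fun i _ => (hc i).le
  have hLx : (#L : ℝ) * x ^ (ε * k / 6) ≤ n := by
    calc (#L : ℝ) * x ^ (ε * k / 6) ≤ m.choose (k - 1 - q) * x ^ q := by
          refine mul_le_mul hcard ?_ (by positivity) (Nat.cast_nonneg _)
          rw [← Real.rpow_natCast]
          exact Real.rpow_le_rpow_of_exponent_le hx1 hqε
      _ ≤ m.choose (k - 1) := choose_sub_mul_pow_le h2k (by omega) hq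
      _ ≤ n := by exact_mod_cast hk.1.le
  have hLr : (#L : ℝ) * costRatio c ≤ ε / 6 * n := by
    rw [costBound_eq hk] at hcost
    calc (#L : ℝ) * costRatio c ≤ #L * (ε / 6 * x ^ (ε * k / 6)) :=
          mul_le_mul_of_nonneg_left hcost (Nat.cast_nonneg _)
      _ = ε / 6 * (#L * x ^ (ε * k / 6)) := by ring
      _ ≤ ε / 6 * n := mul_le_mul_of_nonneg_left hLx (by positivity)
  -- Comparing each light row with every node and averaging over the nodes.
  have havg : (n : ℝ) * ∑ i ∈ L, c i ≤ #L * costRatio c * ∑ j, c j := by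
    have : ∑ j : Fin n, ∑ i ∈ L, c i ≤ ∑ j, ∑ i ∈ L, costRatio c * c j :=
      sum_le_sum fun j _ => sum_le_sum fun i _ => le_costRatio_mul hc i j
    simp only [sum_const, card_univ, Fintype.card_fin, nsmul_eq_mul] at this
    rw [mul_assoc, mul_sum univ c, mul_sum univ]
    exact this
  refine le_of_mul_le_mul_left (havg.trans ?_) hnpos
  calc (#L : ℝ) * costRatio c * ∑ j, c j ≤ ε / 6 * n * ∑ j, c j :=
        mul_le_mul_of_nonneg_right hLr hS
    _ = n * (ε / 6 * ∑ i, c i) := by ring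

/-- All but an `ε / 6` fraction of the cost sits on rows of weight at least `(1 - ε / 3) k`. The
hypothesis `6 ≤ ε * k` makes the rounding of `ε k / 6` harmless. -/
lemma StronglySeparating.le_linearCost {n m k : ℕ} {ε : ℝ} {c : Fin n → ℝ}
    {W : Matrix (Fin n) (Fin m) Bool} (hW : StronglySeparating W) (hk : IsLevel n m k)
    (hε : 0 < ε) (hε1 : ε ≤ 1) (hεk : 6 ≤ ε * k) (hc : ∀ i, 0 < c i)
    (hcost : costRatio c ≤ costBound ε m k) :
    (1 - ε / 3) * (1 - ε / 6) * (k * ∑ i, c i) ≤ linearCost c W := by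
  have hkpos : (0 : ℝ) < k := by exact_mod_cast hk.one_le
  have hk6 : (6 : ℝ) ≤ k := by nlinarith
  set q : ℕ := ⌈ε * k / 6⌉₊ with hq
  have hq1 : ε * k / 6 ≤ q := Nat.le_ceil _
  have hq2 : (q : ℝ) < ε * k / 6 + 1 := Nat.ceil_lt_add_one (by positivity)
  have hqk : q + 1 ≤ k := by
    have : (q : ℝ) + 1 ≤ k := by nlinarith
    exact_mod_cast this
  have hlight := hW.sum_cost_light_le (q := q) hk hε hc (by omega) hq1 hcost
  have hsplit := sum_filter_add_sum_filter_not univ (fun i => rowWeight W i ≤ k - 1 - q) c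
  have hS : 0 ≤ ∑ i, c i := sum_nonneg fun i _ => (hc i).le
  have hheavy : (1 - ε / 6) * ∑ i, c i ≤ ∑ i with ¬ rowWeight W i ≤ k - 1 - q, c i := by
    linarith
  have hweight : (1 - ε / 3) * k ≤ (k : ℝ) - q := by linarith
  calc (1 - ε / 3) * (1 - ε / 6) * (k * ∑ i, c i)
      = ((1 - ε / 3) * k) * ((1 - ε / 6) * ∑ i, c i) := by ring
    _ ≤ (k - q) * ∑ i with ¬ rowWeight W i ≤ k - 1 - q, c i :=
        mul_le_mul hweight hheavy (mul_nonneg (by linarith) hS)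
          ((mul_nonneg (by linarith) hkpos.le).trans hweight)
    _ = ∑ i with ¬ rowWeight W i ≤ k - 1 - q, c i * (k - q) := by rw [mul_comm, sum_mul]
    _ ≤ ∑ i with ¬ rowWeight W i ≤ k - 1 - q, c i * rowWeight W i := by
        refine sum_le_sum fun i hi => mul_le_mul_of_nonneg_left ?_ (hc i).le
        have hi' : k ≤ rowWeight W i + q := by
          have := (mem_filter.1 hi).2
          omega
        have : (k : ℝ) ≤ rowWeight W i + q := by exact_mod_cast hi'
        linarith
    _ ≤ linearCost c W := sum_le_sum_of_subset_of_nonneg (filter_subset _ _)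
        fun i _ _ => mul_nonneg (hc i).le (Nat.cast_nonneg _)

/-- The output costs at most `k` times the total node cost, whatever the number of rows of
weight `k`, and that is already within `1 + ε` of the optimum. -/
lemma ssMatrixApprox_of_isLevel {n m k : ℕ} {ε : ℝ} {c : Fin n → ℝ} (hk : IsLevel n m k)
    (hε : 0 < ε) (hε1 : ε ≤ 1) (hεk : 6 ≤ ε * k) (hc : ∀ i, 0 < c i)
    (hcost : costRatio c ≤ costBound ε m k) : SSMatrixApprox (1 + ε) m c := by
  refine ⟨exists_isSSMatrixOutput c hk, ?_⟩
  rintro U ⟨l, t, T, ζ, ν, h⟩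
  obtain rfl := hk.unique h.level
  refine ⟨h.stronglySeparating, fun W hW => ?_⟩
  have hU : linearCost c U ≤ k * ∑ i, c i := by
    rw [linearCost, mul_sum]
    refine sum_le_sum fun i _ => ?_
    rw [mul_comm]
    exact mul_le_mul_of_nonneg_right (by exact_mod_cast h.rowWeight_le i) (hc i).le
  have hS : 0 ≤ (k : ℝ) * ∑ i, c i :=
    mul_nonneg (Nat.cast_nonneg _) (sum_nonneg fun i _ => (hc i).le)
  have hconst : 1 ≤ (1 + ε) * ((1 - ε / 3) * (1 - ε / 6)) := by
    nlinarith [mul_nonneg hε.le (sub_nonneg.2 hε1), pow_pos hε 3]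
  calc linearCost c U ≤ k * ∑ i, c i := hU
    _ ≤ (1 + ε) * ((1 - ε / 3) * (1 - ε / 6)) * (k * ∑ i, c i) := le_mul_of_one_le_left hS hconst
    _ = (1 + ε) * ((1 - ε / 3) * (1 - ε / 6) * (k * ∑ i, c i)) := by ring
    _ ≤ (1 + ε) * linearCost c W :=
        mul_le_mul_of_nonneg_left (hW.le_linearCost hk hε hε1 hεk hc hcost) (by linarith)

/-! ### Bounds on the level -/

/-- Since `n ≤ C(m, k) ≤ m ^ k`, a budget `m ≤ n ^ (ε / 6)` forces `k ≥ 6 / ε`. -/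
lemma IsLevel.six_le_mul {n m k : ℕ} {ε : ℝ} (h : IsLevel n m k)
    (hm : (m : ℝ) ≤ (n : ℝ) ^ (ε / 6)) : 6 ≤ ε * k := by
  have hn : (1 : ℝ) < n := by exact_mod_cast h.two_le
  have h1 : (n : ℝ) ≤ (m : ℝ) ^ k := by exact_mod_cast h.2.trans (Nat.choose_le_pow m k)
  have h2 : (n : ℝ) ^ (1 : ℝ) ≤ (n : ℝ) ^ (ε / 6 * k) := by
    rw [Real.rpow_one, Real.rpow_mul (by positivity), Real.rpow_natCast]
    exact h1.trans (pow_le_pow_left₀ (Nat.cast_nonneg _) hm k)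
  have := (Real.rpow_le_rpow_left_iff hn).1 h2
  linarith

lemma pow_le_two_pow_of_mul_logb_le {n m r : ℕ} (hn : 0 < n) (h : r * Real.logb 2 n ≤ m) :
    n ^ r ≤ 2 ^ m := by
  have hn0 : (0 : ℝ) < n := by exact_mod_cast hn
  rw [← Real.logb_pow, Real.logb_le_iff_le_rpow (by norm_num) (by positivity),
    Real.rpow_natCast] at h
  exact_mod_cast h

/-- A budget with `2 log₂ n ≤ m ≤ n ^ (1/6)` is large, as `m ^ 12 ≤ n ^ 2 ≤ 2 ^ m`. The rounding
in `m / 3` then does not spoil `2 ^ (m / 2) ≤ 3 ^ (m / 3)`. -/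
lemma le_pow_three_of_le_rpow {n m : ℕ} (hn : 2 ≤ n) (h1 : 2 * Real.logb 2 n ≤ m)
    (h2 : (m : ℝ) ≤ (n : ℝ) ^ ((1 : ℝ) / 6)) : n ≤ 3 ^ (m / 3) := by
  have hsq : n ^ 2 ≤ 2 ^ m := pow_le_two_pow_of_mul_logb_le (by omega) (by exact_mod_cast h1)
  have h6 : m ^ 6 ≤ n := by
    have : (m : ℝ) ^ 6 ≤ ((n : ℝ) ^ ((1 : ℝ) / 6)) ^ 6 := pow_le_pow_left₀ (Nat.cast_nonneg _) h2 6
    rw [← Real.rpow_natCast ((n : ℝ) ^ _), ← Real.rpow_mul (Nat.cast_nonneg _)] at this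
    norm_num at this
    exact_mod_cast this
  have h12 : m ^ 12 ≤ 2 ^ m := by
    calc m ^ 12 = (m ^ 6) ^ 2 := by ring
      _ ≤ n ^ 2 := Nat.pow_le_pow_left h6 2
      _ ≤ 2 ^ m := hsq
  have hm2 : 2 ≤ m := by
    by_contra! hlt
    have : 2 ^ m ≤ 2 ^ 1 := Nat.pow_le_pow_right (by norm_num) (by omega)
    nlinarith
  have hm : 36 ≤ m := by
    by_contra! hlt
    interval_cases m <;> norm_num at h12
  obtain ⟨a, ha⟩ : ∃ a, m / 3 = a + 12 := ⟨m / 3 - 12, by omega⟩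
  rw [ha]
  refine (Nat.pow_le_pow_iff_left two_ne_zero).1 (hsq.trans ?_)
  calc 2 ^ m ≤ 2 ^ (3 * (a + 12) + 2) := Nat.pow_le_pow_right (by norm_num) (by omega)
    _ = 8 ^ a * (8 ^ 12 * 4) := by
      rw [pow_add, pow_mul, pow_add]
      norm_num
      ring
    _ ≤ 9 ^ a * 9 ^ 12 := Nat.mul_le_mul (Nat.pow_le_pow_left (by norm_num) a) (by norm_num)
    _ = (3 ^ (a + 12)) ^ 2 := by rw [← pow_add, ← pow_mul, mul_comm (a + 12), pow_mul]; norm_num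

/-- For a budget of at least `4 log₂ n` no lower bound on `n` is needed. -/
lemma le_pow_three_of_four_mul_logb_le {n m : ℕ} (hn : 2 ≤ n) (h1 : 4 * Real.logb 2 n ≤ m) :
    n ≤ 3 ^ (m / 3) := by
  have h4 : n ^ 4 ≤ 2 ^ m := pow_le_two_pow_of_mul_logb_le (by omega) (by exact_mod_cast h1)
  have hm : 4 ≤ m := by
    have : 2 ^ 4 ≤ 2 ^ m := (Nat.pow_le_pow_left hn 4).trans h4
    exact (Nat.pow_le_pow_iff_right one_lt_two).1 this
  obtain ⟨a, ha⟩ : ∃ a, m / 3 = a + 1 := ⟨m / 3 - 1, by omega⟩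
  rw [ha]
  refine (Nat.pow_le_pow_iff_left four_ne_zero).1 (h4.trans ?_)
  calc 2 ^ m ≤ 2 ^ (3 * (a + 1) + 2) := Nat.pow_le_pow_right (by norm_num) (by omega)
    _ = 8 ^ a * (8 * 4) := by
      rw [pow_add, pow_mul, pow_add]
      norm_num
      ring
    _ ≤ 81 ^ a * 81 := Nat.mul_le_mul (Nat.pow_le_pow_left (by norm_num) a) (by norm_num)
    _ = (3 ^ (a + 1)) ^ 4 := by rw [← pow_succ, ← pow_mul, mul_comm (a + 1), pow_mul]; norm_num

lemma exists_isLevel_of_le_pow_three {n m : ℕ} (hn : 2 ≤ n) (h : n ≤ 3 ^ (m / 3)) :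
    ∃ k, IsLevel n m k :=
  exists_isLevel hn (h.trans (pow_three_le_choose (Nat.mul_div_le m 3)))

lemma IsLevel.three_mul_le {n m k : ℕ} (hk : IsLevel n m k) (h : n ≤ 3 ^ (m / 3)) : 3 * k ≤ m := by
  have := hk.le_of_le_choose (h.trans (pow_three_le_choose (Nat.mul_div_le m 3)))
  omega

/-- If `k ≤ m / 3`, then `C(m, k) ≤ (e m / k) ^ k ≤ (m / (2k)) ^ (7k)`, as `3 x ≤ (x / 2) ^ 7` for
`x ≥ 3`. -/
lemma choose_le_pow_seven_mul {m k : ℕ} (hk : 1 ≤ k) (hkm : 3 * k ≤ m) :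
    (m.choose k : ℝ) ≤ ((m : ℝ) / (2 * k)) ^ (7 * k) := by
  have hk0 : (0 : ℝ) < k := by exact_mod_cast hk
  have h1 : (m.choose k : ℝ) ≤ (m : ℝ) ^ k / (k.factorial : ℝ) := Nat.choose_le_pow_div k m
  have hf0 : (0 : ℝ) < k.factorial := by exact_mod_cast k.factorial_pos
  have h2 : (k : ℝ) ^ k ≤ 3 ^ k * k.factorial := by
    have h := Real.pow_div_factorial_le_exp (k : ℝ) hk0.le k
    rw [div_le_iff₀ hf0] at h
    refine h.trans (mul_le_mul_of_nonneg_right ?_ hf0.le)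
    rw [← mul_one (k : ℝ), Real.exp_nat_mul]
    exact pow_le_pow_left₀ (Real.exp_pos 1).le Real.exp_one_lt_three.le k
  set y : ℝ := (m : ℝ) / (2 * k) with hy
  have hmy : (m : ℝ) = 2 * k * y := by rw [hy]; field_simp
  have hy1 : 3 / 2 ≤ y := by
    rw [hy, le_div_iff₀ (by positivity)]
    have : 3 * (k : ℝ) ≤ m := by exact_mod_cast hkm
    linarith
  have h6 : 6 * y ≤ y ^ 7 := by
    have : (3 / 2 : ℝ) ^ 6 ≤ y ^ 6 := pow_le_pow_left₀ (by norm_num) hy1 6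
    nlinarith
  calc (m.choose k : ℝ) ≤ (m : ℝ) ^ k / (k.factorial : ℝ) := h1
    _ ≤ (6 * y) ^ k := by
      rw [div_le_iff₀ hf0, hmy]
      calc (2 * k * y) ^ k = (2 * y) ^ k * (k : ℝ) ^ k := by rw [← mul_pow]; ring
        _ ≤ (2 * y) ^ k * (3 ^ k * k.factorial) := mul_le_mul_of_nonneg_left h2 (by positivity)
        _ = (6 * y) ^ k * k.factorial := by rw [← mul_assoc, ← mul_pow]; ring
    _ ≤ (y ^ 7) ^ k := pow_le_pow_left₀ (by positivity) h6 k
    _ = y ^ (7 * k) := (pow_mul y 7 k).symm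

/-- For levels `k ≤ m / 3` the explicit bound on the cost ratio is a power of `n`. -/
lemma IsLevel.rpow_le_costBound {n m k : ℕ} {ε δ : ℝ} (h : IsLevel n m k) (hkm : 3 * k ≤ m)
    (hε : 0 < ε) (hδ : δ ≤ 1 / 42) : ε / 6 * (n : ℝ) ^ (δ * ε) ≤ costBound ε m k := by
  rw [costBound_eq h]
  refine mul_le_mul_of_nonneg_left ?_ (by positivity)
  have hn : (1 : ℝ) ≤ n := by exact_mod_cast (by have := h.two_le; omega : 1 ≤ n)
  have hle : (n : ℝ) ≤ ((m : ℝ) / (2 * k)) ^ (7 * k) :=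
    (by exact_mod_cast h.2 : (n : ℝ) ≤ m.choose k).trans (choose_le_pow_seven_mul h.one_le hkm)
  calc (n : ℝ) ^ (δ * ε) ≤ (n : ℝ) ^ (ε / 42) :=
        Real.rpow_le_rpow_of_exponent_le hn (by nlinarith)
    _ ≤ (((m : ℝ) / (2 * k)) ^ (7 * k)) ^ (ε / 42) :=
        Real.rpow_le_rpow (by positivity) hle (by positivity)
    _ = ((m : ℝ) / (2 * k)) ^ (ε * k / 6) := by
        rw [← Real.rpow_natCast, ← Real.rpow_mul (by positivity)]
        congr 1
        push_cast
        ring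

/-- If the budget is at most `C log₂ n`, then `k` is at least a constant times `log₂ n`:
with `y = log₂ n / k`, the bound `n ≤ (m / (2k)) ^ (7k)` gives `y ≤ 7 log₂ (C y / 2)`. -/
lemma IsLevel.logb_le_mul {n m k : ℕ} {C : ℝ} (h : IsLevel n m k) (hkm : 3 * k ≤ m)
    (hC : (m : ℝ) ≤ C * Real.logb 2 n) : Real.logb 2 n ≤ 98 * C * k := by
  have hk0 : (0 : ℝ) < k := by exact_mod_cast h.one_le
  have hn : (1 : ℝ) < n := by exact_mod_cast h.two_le
  have hm0 : (0 : ℝ) < m := by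
    exact_mod_cast (by have := h.one_le; omega : 0 < m)
  have hle : (n : ℝ) ≤ ((m : ℝ) / (2 * k)) ^ (7 * k) :=
    (by exact_mod_cast h.2 : (n : ℝ) ≤ m.choose k).trans (choose_le_pow_seven_mul h.one_le hkm)
  set l := Real.logb 2 n with hl
  have hl0 : 0 < l := Real.logb_pos (by norm_num) hn
  set z : ℝ := (m : ℝ) / (2 * k) with hz
  have hz0 : 0 < z := by positivity
  have h1 : l ≤ 7 * k * Real.logb 2 z := by
    have := Real.logb_le_logb_of_le (by norm_num : (1 : ℝ) < 2) (by linarith) hle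
    rw [Real.logb_pow] at this
    exact_mod_cast this
  have h2 : Real.logb 2 z ≤ 2 * Real.sqrt z := by
    have hs : 0 < Real.sqrt z := Real.sqrt_pos.2 hz0
    have h3 : Real.logb 2 (Real.sqrt z) ≤ Real.sqrt z := by
      have h4 := Real.log_le_sub_one_of_pos (half_pos hs)
      rw [Real.log_div hs.ne' (by norm_num)] at h4
      have h5 := Real.log_two_gt_d9
      have h6 := Real.log_two_lt_d9
      rw [Real.logb, div_le_iff₀ (by linarith)]
      nlinarith
    calc Real.logb 2 z = Real.logb 2 (Real.sqrt z ^ 2) := by rw [Real.sq_sqrt hz0.le]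
      _ = 2 * Real.logb 2 (Real.sqrt z) := by rw [Real.logb_pow]; norm_num
      _ ≤ 2 * Real.sqrt z := by linarith
  have h3 : l ≤ 14 * k * Real.sqrt z := by nlinarith
  have h4 : l ^ 2 ≤ (14 * k * Real.sqrt z) ^ 2 := pow_le_pow_left₀ hl0.le h3 2
  have h5 : (14 * k * Real.sqrt z) ^ 2 = 98 * k * m := by
    rw [mul_pow, Real.sq_sqrt hz0.le, hz]
    field_simp
    norm_num
  have h6 : l * l ≤ (98 * C * k) * l := by nlinarith
  exact le_of_mul_le_mul_right h6 hl0

/-! ### The criterion in terms of `n` -/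

/-- The cost ratio is at least `1`, so a single node never satisfies the upper bound, which is `ε / 6`
for `n = 1`. -/
lemma two_le_of_costRatio_le {n : ℕ} {ε δ : ℝ} (hn : 1 ≤ n) (hε1 : ε ≤ 1) {c : Fin n → ℝ}
    (hc : ∀ i, 0 < c i) (h : costRatio c ≤ ε / 6 * (n : ℝ) ^ (δ * ε)) : 2 ≤ n := by
  by_contra! hlt
  obtain rfl : n = 1 := by omega
  have := one_le_costRatio hn hc
  rw [Nat.cast_one, Real.one_rpow] at h
  linarith

/-- A cost ratio of at least `1` forces `n ^ (δ ε) ≥ 6 / ε ≥ 4`. -/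
lemma two_le_mul_logb_of_costRatio_le {n : ℕ} {ε δ : ℝ} (hn : 1 ≤ n) (hε : 0 < ε) (hε1 : ε ≤ 1)
    {c : Fin n → ℝ} (hc : ∀ i, 0 < c i) (h : costRatio c ≤ ε / 6 * (n : ℝ) ^ (δ * ε)) :
    2 ≤ δ * ε * Real.logb 2 n := by
  have hn0 : (0 : ℝ) < n := by exact_mod_cast hn
  have h1 := (one_le_costRatio hn hc).trans h
  have hp : 0 < (n : ℝ) ^ (δ * ε) := Real.rpow_pos_of_pos hn0 _
  have h4 : (2 : ℝ) ^ (2 : ℝ) ≤ (n : ℝ) ^ (δ * ε) := by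
    norm_num
    nlinarith
  rw [← Real.logb_rpow_eq_mul_logb_of_pos hn0, Real.le_logb_iff_rpow_le (by norm_num) hp]
  exact h4

theorem mainTheorem4 :
    -- the explicit criterion
    (∀ ε : ℝ, 0 < ε → ε ≤ 1 → ∀ (n m k : ℕ) (c : Fin n → ℝ), (∀ i, 0 < c i) →
      IsLevel n m k →
      2 * Real.logb 2 n ≤ m → (m : ℝ) ≤ (n : ℝ) ^ (ε / 6) →
      costRatio c ≤ costBound ε m k →
      SSMatrixApprox (1 + ε) m c) ∧
    -- part (a)
    (∀ c₁ : ℝ, 1 < c₁ → ∃ δ : ℝ, 0 < δ ∧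
      ∀ ε : ℝ, 0 < ε → ε ≤ 1 → ∀ n m : ℕ, 1 ≤ n →
        (2 * Real.logb 2 n) ^ c₁ ≤ (m : ℝ) → (m : ℝ) ≤ (n : ℝ) ^ (ε / 6) →
        (∀ k : ℕ, IsLevel n m k → ε / 6 * (n : ℝ) ^ (δ * ε) ≤ costBound ε m k) ∧
        (∀ c : Fin n → ℝ, (∀ i, 0 < c i) → costRatio c ≤ ε / 6 * (n : ℝ) ^ (δ * ε) →
          SSMatrixApprox (1 + ε) m c)) ∧
    -- part (b)
    (∀ c₂ : ℝ, ∃ δ : ℝ, 0 < δ ∧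
      ∀ ε : ℝ, 0 < ε → ε ≤ 1 → ∀ n m : ℕ, 1 ≤ n →
        4 * Real.logb 2 n ≤ (m : ℝ) → (m : ℝ) ≤ c₂ * Real.logb 2 n →
        (∀ k : ℕ, IsLevel n m k → ε / 6 * (n : ℝ) ^ (δ * ε) ≤ costBound ε m k) ∧
        (∀ c : Fin n → ℝ, (∀ i, 0 < c i) → costRatio c ≤ ε / 6 * (n : ℝ) ^ (δ * ε) →
          SSMatrixApprox (1 + ε) m c)) := by
  refine ⟨?_, ?_, ?_⟩
  · intro ε hε hε1 n m k c hc hk _ hm hcost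
    exact ssMatrixApprox_of_isLevel hk hε hε1 (hk.six_le_mul hm) hc hcost
  · intro c₁ hc₁
    refine ⟨1 / 42, by norm_num, fun ε hε hε1 n m hn hm1 hm2 => ?_⟩
    have hpow : 2 ≤ n → n ≤ 3 ^ (m / 3) := fun hn2 => by
      have hl : 1 ≤ Real.logb 2 n := by
        rw [Real.le_logb_iff_rpow_le (by norm_num) (by positivity), Real.rpow_one]
        exact_mod_cast hn2
      refine le_pow_three_of_le_rpow hn2 (le_trans ?_ hm1) (hm2.trans ?_)
      · exact Real.self_le_rpow_of_one_le (by linarith) hc₁.le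
      · exact Real.rpow_le_rpow_of_exponent_le (by exact_mod_cast hn) (by linarith)
    have hbound : ∀ k : ℕ, IsLevel n m k →
        ε / 6 * (n : ℝ) ^ (1 / 42 * ε) ≤ costBound ε m k := fun k hk =>
      hk.rpow_le_costBound (hk.three_mul_le (hpow hk.two_le)) hε le_rfl
    refine ⟨hbound, fun c hc hcost => ?_⟩
    have hn2 := two_le_of_costRatio_le hn hε1 hc hcost
    obtain ⟨k, hk⟩ := exists_isLevel_of_le_pow_three hn2 (hpow hn2)
    exact ssMatrixApprox_of_isLevel hk hε hε1 (hk.six_le_mul hm2) hc (hcost.trans (hbound k hk))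
  · intro c₂
    -- `294 = 3 * 98`, with the constant of `IsLevel.logb_le_mul`.
    have hC1 : (1 : ℝ) ≤ max c₂ 1 := le_max_right _ _
    set C : ℝ := max c₂ 1 with hC
    refine ⟨1 / (294 * C), by positivity, fun ε hε hε1 n m hn hm1 hm2 => ?_⟩
    have hδ : 1 / (294 * C) ≤ 1 / 42 := one_div_le_one_div_of_le (by norm_num) (by linarith)
    have hbound : ∀ k : ℕ, IsLevel n m k →
        ε / 6 * (n : ℝ) ^ (1 / (294 * C) * ε) ≤ costBound ε m k := fun k hk =>
      hk.rpow_le_costBound (hk.three_mul_le (le_pow_three_of_four_mul_logb_le hk.two_le hm1)) hε hδ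
    refine ⟨hbound, fun c hc hcost => ?_⟩
    have hn2 := two_le_of_costRatio_le hn hε1 hc hcost
    have hpow := le_pow_three_of_four_mul_logb_le hn2 hm1
    obtain ⟨k, hk⟩ := exists_isLevel_of_le_pow_three hn2 hpow
    have hl : 0 ≤ Real.logb 2 n := Real.logb_nonneg (by norm_num) (by exact_mod_cast hn)
    have hmC : (m : ℝ) ≤ C * Real.logb 2 n :=
      hm2.trans (mul_le_mul_of_nonneg_right (le_max_left _ _) hl)
    have hεk : 6 ≤ ε * k := by
      have h1 := two_le_mul_logb_of_costRatio_le hn hε hε1 hc hcost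
      have h2 := hk.logb_le_mul (hk.three_mul_le hpow) hmC
      have h3 : 1 / (294 * C) * ε * Real.logb 2 n ≤ 1 / (294 * C) * ε * (98 * C * k) :=
        mul_le_mul_of_nonneg_left h2 (by positivity)
      have h4 : 1 / (294 * C) * ε * (98 * C * k) = ε * k / 3 := by
        field_simp
        ring
      linarith
    exact ssMatrixApprox_of_isLevel hk hε hε1 hεk hc (hcost.trans (hbound k hk))
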